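/- Let $k\in(0,1)$, $k'=\sqrt{1-k^2}$, and put $\kappa=\frac{1-k}{1+k}$, $\kappa'=\sqrt{1-\kappa^2}$ and $a=\kappa^{1/2}$. Let $K(\cdot)$ denote the complete elliptic integral of the first kind as a function of the modulus, and let $\operatorname{sn},\operatorname{cn},\operatorname{dn}$ be the Jacobian elliptic functions. For $R>0$ and $z\in\mathbb R$ we say that (i) $(\mu,\nu)$ are Moon–Spencer bi-cyclide coordinates of $(R,z)$ if $-K(\kappa)<\mu<K(\kappa)$, $0<\nu<K(\kappa')$ and, with $\Lambda=1-\operatorname{dn}^2(\mu,\kappa)\operatorname{sn}^2(\nu,\kappa')$, $$R=\frac a\Lambda\operatorname{cn}(\mu,\kappa)\operatorname{dn}(\mu,\kappa)\operatorname{sn}(\nu,\kappa')\operatorname{cn}(\nu,\kappa'),\qquad z=\frac a\Lambda\operatorname{sn}(\mu,\kappa)\operatorname{dn}(\nu,\kappa');$$ (ii) $(s,t)$ are bi-cyclide coordinates of $(R,z)$ with modulus $k$ if $-K(k)<s<K(k)$, $-K(k')<t<K(k')$ and $$R=\frac{\operatorname{cn}(s,k)\operatorname{cn}(t,k')}{1-\operatorname{sn}(s,k)\operatorname{dn}(t,k')},\qquad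 z=\frac{\operatorname{dn}(s,k)\operatorname{sn}(t,k')}{1-\operatorname{sn}(s,k)\operatorname{dn}(t,k')}.$$ Then every point $(R,z)$ with $R>0$ has exactly one pair of coordinates $(\mu,\nu)$ as in (i) and exactly one pair $(s,t)$ as in (ii), and these are connected by $$t=(1+\kappa)\mu,\qquad s+K(k)=(1+\kappa)\nu .$$ -/

import Mathlib

noncomputable section

namespace BiCyclide

/-- Legendre's incomplete elliptic integral of the first kind with modulus `k`. -/
def ellipticF (k φ : ℝ) : ℝ :=
  ∫ θ in (0 : ℝ)..φ, 1 / √(1 - k ^ 2 * Real.sin θ ^ 2)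

/-- The complete elliptic integral of the first kind `K(k)`. -/
def ellipticK (k : ℝ) : ℝ := ellipticF k (Real.pi / 2)

/-- The complementary modulus. -/
def compl (k : ℝ) : ℝ := √(1 - k ^ 2)

/-- Jacobi's amplitude `am(u, k)`, the inverse of `φ ↦ F(φ, k)`. For `k ^ 2 < 1` it is a genuine
two-sided inverse, see `ellipticF_am` and `am_ellipticF`. -/
def am (u k : ℝ) : ℝ := Function.invFun (ellipticF k) u

/-- The Jacobian elliptic function `sn(u, k)` for real `u`. -/
def sn (u k : ℝ) : ℝ := Real.sin (am u k)

/-- The Jacobian elliptic function `cn(u, k)` for real `u`. -/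
def cn (u k : ℝ) : ℝ := Real.cos (am u k)

/-- The Jacobian elliptic function `dn(u, k)` for real `u`. -/
def dn (u k : ℝ) : ℝ := √(1 - k ^ 2 * sn u k ^ 2)

/-- `(s, t)` are bi-cyclide coordinates with modulus `k` of the point at distance `R` from the axis
of rotation and height `z`. -/
structure IsBiCyclideCoord (k s t R z : ℝ) : Prop where
  s_mem : s ∈ Set.Ioo (-ellipticK k) (ellipticK k)
  t_mem : t ∈ Set.Ioo (-ellipticK (compl k)) (ellipticK (compl k))
  R_eq : R = cn s k * cn t (compl k) / (1 - sn s k * dn t (compl k))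
  z_eq : z = dn s k * sn t (compl k) / (1 - sn s k * dn t (compl k))

/-- The denominator `Λ` in the coordinates of Moon and Spencer. -/
def msDenom (κ μ ν : ℝ) : ℝ := 1 - dn μ κ ^ 2 * sn ν (compl κ) ^ 2

/-- `(μ, ν)` are Moon–Spencer bi-cyclide coordinates with scale `a` and modulus `κ` of the point at
distance `R` from the axis of rotation and height `z`. -/
structure IsMoonSpencerCoord (a κ μ ν R z : ℝ) : Prop where
  μ_mem : μ ∈ Set.Ioo (-ellipticK κ) (ellipticK κ)
  ν_mem : ν ∈ Set.Ioo 0 (ellipticK (compl κ))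
  R_eq : R = a / msDenom κ μ ν *
    (cn μ κ * dn μ κ * sn ν (compl κ) * cn ν (compl κ))
  z_eq : z = a / msDenom κ μ ν * (sn μ κ * dn ν (compl κ))

theorem one_sub_pos {k : ℝ} (hk : k ^ 2 < 1) (θ : ℝ) : 0 < 1 - k ^ 2 * Real.sin θ ^ 2 := by
  nlinarith [Real.sin_sq_le_one θ, sq_nonneg k]

theorem hasDerivAt_ellipticF {k : ℝ} (hk : k ^ 2 < 1) (φ : ℝ) :
    HasDerivAt (ellipticF k) (1 / √(1 - k ^ 2 * Real.sin φ ^ 2)) φ := by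
  have hc : Continuous fun θ : ℝ => 1 / √(1 - k ^ 2 * Real.sin θ ^ 2) :=
    continuous_const.div (by fun_prop) fun θ => (Real.sqrt_pos.2 (one_sub_pos hk θ)).ne'
  exact hc.integral_hasStrictDerivAt 0 φ |>.hasDerivAt

theorem ellipticF_bijective {k : ℝ} (hk : k ^ 2 < 1) : Function.Bijective (ellipticF k) := by
  have hd := hasDerivAt_ellipticF hk
  have hge : ∀ φ : ℝ, 1 ≤ 1 / √(1 - k ^ 2 * Real.sin φ ^ 2) := fun φ => by
    rw [le_div_iff₀ (Real.sqrt_pos.2 (one_sub_pos hk φ)), one_mul]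
    exact Real.sqrt_le_one.2 (by nlinarith [mul_nonneg (sq_nonneg k) (sq_nonneg (Real.sin φ))])
  have h0 : ellipticF k 0 = 0 := by simp [ellipticF]
  have hmono : Monotone fun φ => ellipticF k φ - φ := by
    have hd' := fun φ => (hd φ).sub (hasDerivAt_id φ)
    refine monotone_of_deriv_nonneg (fun φ => (hd' φ).differentiableAt) fun φ => ?_
    have := (hd' φ).deriv
    exact (sub_nonneg.2 (hge φ)).trans_eq this.symm
  constructor
  · refine StrictMono.injective fun x y hxy => ?_
    have := hmono hxy.le
    simp only at this
    linarith
  · have hc : Continuous (ellipticF k) :=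
      continuous_iff_continuousAt.2 fun φ => (hd φ).continuousAt
    refine hc.surjective ?_ ?_
    · refine Filter.tendsto_atTop_mono' _ ?_ Filter.tendsto_id
      filter_upwards [Filter.eventually_ge_atTop 0] with φ hφ
      have := hmono hφ
      simp only [h0] at this
      simp only [id]; linarith
    · refine Filter.tendsto_atBot_mono' _ ?_ Filter.tendsto_id
      filter_upwards [Filter.eventually_le_atBot 0] with φ hφ
      have := hmono hφ
      simp only [h0] at this
      simp only [id]; linarith

theorem ellipticF_am {k : ℝ} (hk : k ^ 2 < 1) (u : ℝ) : ellipticF k (am u k) = u :=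
  Function.rightInverse_invFun (ellipticF_bijective hk).2 u

theorem am_ellipticF {k : ℝ} (hk : k ^ 2 < 1) (φ : ℝ) : am (ellipticF k φ) k = φ :=
  Function.leftInverse_invFun (ellipticF_bijective hk).1 φ

end BiCyclide

end

open Real Set

namespace BiCyclide

/-! Put w = sn s · dn t, v = dn s · sn t and r = cn s · cn t. Then r² + v² + w² = 1, and (ii) is the
stereographic projection R = r/(1 - w), z = v/(1 - w). So (s, t) are sphero-conal coordinates on the
open hemisphere r > 0: `exists_spheroConal` finds sn² s as a root of a quadratic, and
`spheroConal_injective` gives uniqueness.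

System (i) is (ii) in disguise. Since k = (1 - κ)/(1 + κ) and k'² = 4κ/(1 + κ)², Gauss's
transformation in μ and a shifted Landen transformation in ν express the functions of (1 + κ)μ and
(1 + κ)ν - K(k) through those of μ and ν. Both come from substitutions in Legendre's integral
(`ellipticF_arcsin_sub`), whose values at π/2 also match the parameter ranges.
`isMoonSpencerCoord_iff` combines these facts and transfers existence and uniqueness from (ii) to
(i). -/

/-! ### Inverting Legendre's integral on a quarter period. -/

theorem ellipticF_zero (k : ℝ) : ellipticF k 0 = 0 := by simp [ellipticF]

theorem ellipticF_neg (k φ : ℝ) : ellipticF k (-φ) = -ellipticF k φ := by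
  have h := intervalIntegral.integral_comp_neg (a := 0) (b := φ)
    (fun θ : ℝ => 1 / √(1 - k ^ 2 * Real.sin θ ^ 2))
  simp only [Real.sin_neg, neg_sq, neg_zero] at h
  rw [ellipticF, intervalIntegral.integral_symm, ellipticF, h]

theorem ellipticF_strictMono {k : ℝ} (hk : k ^ 2 < 1) : StrictMono (ellipticF k) :=
  strictMono_of_deriv_pos fun φ => by
    rw [(hasDerivAt_ellipticF hk φ).deriv]
    exact one_div_pos.2 (Real.sqrt_pos.2 (one_sub_pos hk φ))

theorem ellipticF_continuous {k : ℝ} (hk : k ^ 2 < 1) : Continuous (ellipticF k) :=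
  continuous_iff_continuousAt.2 fun φ => (hasDerivAt_ellipticF hk φ).continuousAt

theorem ellipticF_mem_Ioo_iff {k : ℝ} (hk : k ^ 2 < 1) (φ : ℝ) :
    ellipticF k φ ∈ Ioo (-ellipticK k) (ellipticK k) ↔ φ ∈ Ioo (-(π / 2)) (π / 2) := by
  rw [ellipticK, ← ellipticF_neg, mem_Ioo, mem_Ioo, (ellipticF_strictMono hk).lt_iff_lt,
    (ellipticF_strictMono hk).lt_iff_lt]

theorem am_mem_Ioo {k u : ℝ} (hk : k ^ 2 < 1) (hu : u ∈ Ioo (-ellipticK k) (ellipticK k)) :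
    am u k ∈ Ioo (-(π / 2)) (π / 2) := by
  rwa [← ellipticF_mem_Ioo_iff hk, ellipticF_am hk]

theorem cn_pos {k u : ℝ} (hk : k ^ 2 < 1) (hu : u ∈ Ioo (-ellipticK k) (ellipticK k)) :
    0 < cn u k := Real.cos_pos_of_mem_Ioo (am_mem_Ioo hk hu)

theorem sn_sq_add_cn_sq (u k : ℝ) : sn u k ^ 2 + cn u k ^ 2 = 1 := Real.sin_sq_add_cos_sq _

theorem dn_pos {k : ℝ} (hk : k ^ 2 < 1) (u : ℝ) : 0 < dn u k :=
  Real.sqrt_pos.2 (one_sub_pos hk _)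

theorem dn_sq {k : ℝ} (hk : k ^ 2 < 1) (u : ℝ) : dn u k ^ 2 = 1 - k ^ 2 * sn u k ^ 2 :=
  Real.sq_sqrt (one_sub_pos hk _).le

theorem eq_ellipticF_arcsin_sn {k u : ℝ} (hk : k ^ 2 < 1)
    (hu : u ∈ Ioo (-ellipticK k) (ellipticK k)) : u = ellipticF k (arcsin (sn u k)) := by
  have h := am_mem_Ioo hk hu
  rw [sn, Real.arcsin_sin h.1.le h.2.le, ellipticF_am hk]

theorem sn_injOn {k u v : ℝ} (hk : k ^ 2 < 1) (hu : u ∈ Ioo (-ellipticK k) (ellipticK k))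
    (hv : v ∈ Ioo (-ellipticK k) (ellipticK k)) (h : sn u k = sn v k) : u = v := by
  rw [eq_ellipticF_arcsin_sn hk hu, h, ← eq_ellipticF_arcsin_sn hk hv]

theorem sn_ellipticF_arcsin {k S : ℝ} (hk : k ^ 2 < 1) (h₁ : -1 ≤ S) (h₂ : S ≤ 1) :
    sn (ellipticF k (arcsin S)) k = S := by
  rw [sn, am_ellipticF hk, Real.sin_arcsin h₁ h₂]

theorem ellipticF_arcsin_mem_Ioo {k S : ℝ} (hk : k ^ 2 < 1) (h₁ : -1 < S) (h₂ : S < 1) :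
    ellipticF k (arcsin S) ∈ Ioo (-ellipticK k) (ellipticK k) :=
  (ellipticF_mem_Ioo_iff hk _).2 ⟨Real.neg_pi_div_two_lt_arcsin.2 h₁, Real.arcsin_lt_pi_div_two.2 h₂⟩

theorem compl_sq {k : ℝ} (hk : k ^ 2 < 1) : compl k ^ 2 = 1 - k ^ 2 :=
  Real.sq_sqrt (by linarith)

theorem compl_sq_lt_one {k : ℝ} (hk0 : 0 < k) (hk : k ^ 2 < 1) : compl k ^ 2 < 1 := by
  rw [compl_sq hk]; nlinarith

/-! ### Landen and Gauss transformations of Legendre's integral. -/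

/-- Change of variables `sin ψ = g φ` in Legendre's integral. -/
theorem ellipticF_arcsin_sub {k m c a b : ℝ} {g g' : ℝ → ℝ} (hk : k ^ 2 < 1) (hm : m ^ 2 < 1)
    (hab : a ≤ b) (hgc : ContinuousOn g (Icc a b))
    (hg : ∀ x ∈ Ioo a b, HasDerivAt g (g' x) x)
    (hg1 : ∀ x ∈ Ioo a b, g x ∈ Ioo (-1) 1)
    (hg' : ∀ x ∈ Ioo a b, g' x * √(1 - m ^ 2 * Real.sin x ^ 2) =
      c * (√(1 - k ^ 2 * g x ^ 2) * √(1 - g x ^ 2))) :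
    ellipticF k (arcsin (g b)) - ellipticF k (arcsin (g a)) =
      c * (ellipticF m b - ellipticF m a) := by
  rcases hab.eq_or_lt with rfl | hab
  · simp
  -- The mean value theorem needs differentiability only in the interior; at the endpoints `g` may
  -- reach ±1, where `arcsin` is merely continuous.
  obtain ⟨x, -, hx⟩ := exists_hasDerivAt_eq_slope
    (fun x => ellipticF k (arcsin (g x)) - c * ellipticF m x) (fun _ => 0) hab
    ((((ellipticF_continuous hk).comp Real.continuous_arcsin).comp_continuousOn hgc).sub
      (continuous_const.mul (ellipticF_continuous hm)).continuousOn) fun x hx => by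
    have h1 := hg1 x hx
    have h := ((hasDerivAt_ellipticF hk _).comp x
      ((Real.hasDerivAt_arcsin h1.1.ne' h1.2.ne).comp x (hg x hx))).sub
      ((hasDerivAt_ellipticF hm x).const_mul c)
    refine h.congr_deriv ?_
    simp only [Function.comp_apply]
    rw [Real.sin_arcsin h1.1.le h1.2.le]
    have e1 : 0 < √(1 - g x ^ 2) := Real.sqrt_pos.2 (by nlinarith [h1.1, h1.2])
    have e2 : 0 < √(1 - k ^ 2 * g x ^ 2) := by
      have := one_sub_pos hk (arcsin (g x))
      rw [Real.sin_arcsin h1.1.le h1.2.le] at this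
      exact Real.sqrt_pos.2 this
    have e3 : 0 < √(1 - m ^ 2 * Real.sin x ^ 2) := Real.sqrt_pos.2 (one_sub_pos hm x)
    have h' := hg' x hx
    field_simp
    linarith
  rw [eq_comm, div_eq_zero_iff, or_iff_left (sub_pos.2 hab).ne'] at hx
  linarith

/-- The ascending Landen transformation, `x = sn (μ, κ)`. -/
noncomputable def landenUp (κ x : ℝ) : ℝ := (1 + κ) * x / (1 + κ * x ^ 2)

/-- The descending Landen transformation followed by a shift by a quarter period,
`y = sn (ν, κ')`. -/
noncomputable def landenDown (κ y : ℝ) : ℝ := ((1 + κ) * y ^ 2 - 1) / (1 - (1 - κ) * y ^ 2)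

theorem landenUp_denom_pos {κ : ℝ} (h0 : 0 < κ) (x : ℝ) : 0 < 1 + κ * x ^ 2 := by positivity

theorem landenDown_denom_pos {κ y : ℝ} (h0 : 0 < κ) (h1 : κ < 1) (hy : y ^ 2 ≤ 1) :
    0 < 1 - (1 - κ) * y ^ 2 := by nlinarith

/-- This factorization and the next three serve twice: they simplify the radicals under the
substitutions, and they yield the transformed cn and dn. -/
theorem one_sub_landenUp_sq {κ : ℝ} (h0 : 0 < κ) (x : ℝ) :
    1 - landenUp κ x ^ 2 = (1 - x ^ 2) * (1 - κ ^ 2 * x ^ 2) / (1 + κ * x ^ 2) ^ 2 := by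
  have := landenUp_denom_pos h0 x
  rw [landenUp]; field_simp; ring

theorem one_sub_mul_landenUp_sq {κ : ℝ} (h0 : 0 < κ) (x : ℝ) :
    1 - 4 * κ / (1 + κ) ^ 2 * landenUp κ x ^ 2 = ((1 - κ * x ^ 2) / (1 + κ * x ^ 2)) ^ 2 := by
  have := landenUp_denom_pos h0 x
  rw [landenUp]; field_simp; ring

theorem one_sub_landenDown_sq {κ y : ℝ} (h0 : 0 < κ) (h1 : κ < 1) (hy : y ^ 2 ≤ 1) :
    1 - landenDown κ y ^ 2 = 4 * κ * y ^ 2 * (1 - y ^ 2) / (1 - (1 - κ) * y ^ 2) ^ 2 := by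
  have := landenDown_denom_pos h0 h1 hy
  rw [landenDown, div_pow, eq_div_iff (pow_ne_zero 2 this.ne'), sub_mul,
    div_mul_cancel₀ _ (pow_ne_zero 2 this.ne')]
  ring

theorem one_sub_mul_landenDown_sq {κ y : ℝ} (h0 : 0 < κ) (h1 : κ < 1) (hy : y ^ 2 ≤ 1) :
    1 - ((1 - κ) / (1 + κ)) ^ 2 * landenDown κ y ^ 2 =
      4 * κ * (1 - (1 - κ ^ 2) * y ^ 2) / ((1 + κ) * (1 - (1 - κ) * y ^ 2)) ^ 2 := by
  have := landenDown_denom_pos h0 h1 hy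
  rw [landenDown]; field_simp; ring

theorem mem_Ioo_of_one_sub_sq_pos {x : ℝ} (h : 0 < 1 - x ^ 2) : x ∈ Ioo (-1 : ℝ) 1 :=
  abs_lt.1 ((sq_lt_one_iff_abs_lt_one x).1 (by linarith))

theorem hasDerivAt_landenUp {κ : ℝ} (h0 : 0 < κ) (x : ℝ) :
    HasDerivAt (landenUp κ) ((1 + κ) * (1 - κ * x ^ 2) / (1 + κ * x ^ 2) ^ 2) x := by
  have h := (((hasDerivAt_id x).const_mul (1 + κ)).div
    ((((hasDerivAt_id x).pow 2).const_mul κ).const_add 1) (landenUp_denom_pos h0 x).ne')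
  refine h.congr_deriv ?_
  simp only [id, Nat.cast_ofNat, Pi.pow_apply]
  congr 1
  ring

theorem hasDerivAt_landenDown {κ y : ℝ} (h0 : 0 < κ) (h1 : κ < 1) (hy : y ^ 2 ≤ 1) :
    HasDerivAt (landenDown κ) (4 * κ * y / (1 - (1 - κ) * y ^ 2) ^ 2) y := by
  have h := ((((hasDerivAt_id y).pow 2).const_mul (1 + κ)).sub_const 1).div
    ((((hasDerivAt_id y).pow 2).const_mul (1 - κ)).const_sub 1)
    (landenDown_denom_pos h0 h1 hy).ne'
  refine h.congr_deriv ?_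
  simp only [id, Nat.cast_ofNat, Pi.pow_apply]
  congr 1
  ring

theorem one_sub_mul_sq_pos {m y : ℝ} (hm : m ^ 2 < 1) (hy : y ^ 2 ≤ 1) :
    0 < 1 - m ^ 2 * y ^ 2 := by nlinarith [sq_nonneg m]

/-- Gauss's transformation for Legendre's integral. -/
theorem ellipticF_landenUp_sub {κ l a b : ℝ} (h0 : 0 < κ) (h1 : κ < 1)
    (hl : l ^ 2 = 4 * κ / (1 + κ) ^ 2) (hl1 : l ^ 2 < 1) (ha : -(π / 2) ≤ a) (hab : a ≤ b)
    (hb : b ≤ π / 2) :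
    ellipticF l (arcsin (landenUp κ (Real.sin b))) -
      ellipticF l (arcsin (landenUp κ (Real.sin a))) =
        (1 + κ) * (ellipticF κ b - ellipticF κ a) := by
  have hκ : κ ^ 2 < 1 := by nlinarith
  have hd : ∀ x, HasDerivAt (fun x => landenUp κ (Real.sin x)) _ x := fun x =>
    (hasDerivAt_landenUp h0 _).comp x (Real.hasDerivAt_sin x)
  refine ellipticF_arcsin_sub (g := fun x => landenUp κ (Real.sin x)) hl1 hκ hab
    (continuous_iff_continuousAt.2 fun x => (hd x).continuousAt).continuousOn
    (fun x _ => hd x) ?_ ?_ <;> intro x hx <;>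
    have hc : 0 < Real.cos x := Real.cos_pos_of_mem_Ioo ⟨by linarith [hx.1], by linarith [hx.2]⟩ <;>
    have hp := landenUp_denom_pos h0 (Real.sin x) <;>
    have he := one_sub_pos hκ x <;>
    have e := one_sub_landenUp_sq h0 (Real.sin x) <;>
    rw [← Real.cos_sq'] at e
  · exact mem_Ioo_of_one_sub_sq_pos (e ▸ by positivity)
  · have hn : 0 < 1 - κ * Real.sin x ^ 2 := by nlinarith [Real.sin_sq_le_one x]
    rw [hl, one_sub_mul_landenUp_sq h0, e, Real.sqrt_sq (by positivity),
      Real.sqrt_div (by positivity), Real.sqrt_mul (by positivity), Real.sqrt_sq hc.le,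
      Real.sqrt_sq hp.le]
    field_simp

/-- Landen's transformation for Legendre's integral, shifted by a quarter period. -/
theorem ellipticF_landenDown_sub {κ l k a b : ℝ} (h0 : 0 < κ) (h1 : κ < 1)
    (hl : l ^ 2 = 1 - κ ^ 2) (hk : k = (1 - κ) / (1 + κ)) (hk1 : k ^ 2 < 1) (ha : 0 ≤ a)
    (hab : a ≤ b) (hb : b ≤ π / 2) :
    ellipticF k (arcsin (landenDown κ (Real.sin b))) -
      ellipticF k (arcsin (landenDown κ (Real.sin a))) =
        (1 + κ) * (ellipticF l b - ellipticF l a) := by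
  have hl1 : l ^ 2 < 1 := by nlinarith
  have hd : ∀ x, HasDerivAt (fun x => landenDown κ (Real.sin x)) _ x := fun x =>
    (hasDerivAt_landenDown h0 h1 (Real.sin_sq_le_one x)).comp x (Real.hasDerivAt_sin x)
  refine ellipticF_arcsin_sub (g := fun x => landenDown κ (Real.sin x)) hk1 hl1 hab
    (continuous_iff_continuousAt.2 fun x => (hd x).continuousAt).continuousOn
    (fun x _ => hd x) ?_ ?_ <;> intro x hx <;>
    have hc : 0 < Real.cos x := Real.cos_pos_of_mem_Ioo
      ⟨by linarith [hx.1, Real.pi_pos], by linarith [hx.2]⟩ <;>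
    have hs : 0 < Real.sin x := Real.sin_pos_of_pos_of_lt_pi (by linarith [hx.1])
      (by linarith [hx.2, Real.pi_pos]) <;>
    have hp := landenDown_denom_pos h0 h1 (Real.sin_sq_le_one x) <;>
    have he := one_sub_pos hl1 x <;>
    have e := one_sub_landenDown_sq h0 h1 (Real.sin_sq_le_one x) <;>
    rw [← Real.cos_sq'] at e
  · exact mem_Ioo_of_one_sub_sq_pos (e ▸ by positivity)
  · have hq := Real.sq_sqrt h0.le
    rw [hk, one_sub_mul_landenDown_sq h0 h1 (Real.sin_sq_le_one x), e, ← hl,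
      Real.sqrt_div (by positivity), Real.sqrt_div (by positivity), Real.sqrt_sq hp.le,
      Real.sqrt_sq (by positivity),
      -- Writing κ as (√κ)² makes the numerator a perfect square, so the radical disappears.
      show 4 * κ * Real.sin x ^ 2 * Real.cos x ^ 2 = (2 * √κ * Real.sin x * Real.cos x) ^ 2 by
        rw [mul_pow, mul_pow, mul_pow, hq]; ring,
      Real.sqrt_sq (by positivity),
      show 4 * κ = (2 * √κ) ^ 2 by rw [mul_pow, hq]; ring,
      Real.sqrt_mul (by positivity), Real.sqrt_sq (by positivity)]
    field_simp

theorem ellipticF_landenUp {κ l φ : ℝ} (h0 : 0 < κ) (h1 : κ < 1)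
    (hl : l ^ 2 = 4 * κ / (1 + κ) ^ 2) (hl1 : l ^ 2 < 1) (hφ : φ ∈ Icc (-(π / 2)) (π / 2)) :
    ellipticF l (arcsin (landenUp κ (Real.sin φ))) = (1 + κ) * ellipticF κ φ := by
  have hz : landenUp κ (Real.sin 0) = 0 := by simp [landenUp]
  rcases le_total 0 φ with h | h
  · have := ellipticF_landenUp_sub h0 h1 hl hl1 (by linarith [Real.pi_pos]) h hφ.2
    simpa [hz, ellipticF_zero, -Real.sin_zero] using this
  · have := ellipticF_landenUp_sub h0 h1 hl hl1 hφ.1 h (by linarith [Real.pi_pos])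
    simp only [hz, ellipticF_zero, Real.arcsin_zero] at this
    linarith

theorem ellipticK_landenUp {κ l : ℝ} (h0 : 0 < κ) (h1 : κ < 1)
    (hl : l ^ 2 = 4 * κ / (1 + κ) ^ 2) (hl1 : l ^ 2 < 1) :
    ellipticK l = (1 + κ) * ellipticK κ := by
  have := ellipticF_landenUp h0 h1 hl hl1 (φ := π / 2) ⟨by linarith [Real.pi_pos], le_rfl⟩
  rwa [Real.sin_pi_div_two, show landenUp κ 1 = 1 by rw [landenUp]; field_simp,
    Real.arcsin_one] at this

/-- The base point 0 is sent to -1, whose integral is -K(k); this is the source of the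
quarter-period shift. -/
theorem ellipticF_landenDown {κ l k φ : ℝ} (h0 : 0 < κ) (h1 : κ < 1)
    (hl : l ^ 2 = 1 - κ ^ 2) (hk : k = (1 - κ) / (1 + κ)) (hk1 : k ^ 2 < 1)
    (hφ : φ ∈ Icc 0 (π / 2)) :
    ellipticF k (arcsin (landenDown κ (Real.sin φ))) + ellipticK k =
      (1 + κ) * ellipticF l φ := by
  have := ellipticF_landenDown_sub h0 h1 hl hk hk1 le_rfl hφ.1 hφ.2
  simpa [show landenDown κ 0 = -1 by simp [landenDown], ellipticF_zero, ellipticF_neg,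
    ellipticK] using this

theorem ellipticK_landenDown {κ l k : ℝ} (h0 : 0 < κ) (h1 : κ < 1)
    (hl : l ^ 2 = 1 - κ ^ 2) (hk : k = (1 - κ) / (1 + κ)) (hk1 : k ^ 2 < 1) :
    2 * ellipticK k = (1 + κ) * ellipticK l := by
  have := ellipticF_landenDown h0 h1 hl hk hk1 (φ := π / 2) ⟨by positivity, le_rfl⟩
  rw [Real.sin_pi_div_two, show landenDown κ 1 = 1 by
    rw [landenDown, one_pow, mul_one, mul_one, add_sub_cancel_left, sub_sub_cancel,
      div_self h0.ne'], Real.arcsin_one] at this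
  rw [ellipticK] at *
  linarith!

/-! ### Sphero-conal coordinates. -/

/-- Sphero-conal coordinates on an open hemisphere: existence. -/
theorem exists_spheroConal {k l r v w : ℝ} (hk0 : 0 < k) (hk1 : k < 1) (hl : l ^ 2 = 1 - k ^ 2)
    (hr : 0 < r) (h : r ^ 2 + v ^ 2 + w ^ 2 = 1) :
    ∃ S ∈ Ioo (-1 : ℝ) 1, ∃ T ∈ Ioo (-1 : ℝ) 1, w = S * √(1 - l ^ 2 * T ^ 2) ∧
      v = √(1 - k ^ 2 * S ^ 2) * T ∧ r ^ 2 = (1 - S ^ 2) * (1 - T ^ 2) := by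
  have hk : k ^ 2 < 1 := by nlinarith
  have hl1 : l ^ 2 < 1 := by nlinarith
  -- Here x stands for S²; the quadratic results from eliminating T². It equals w² ≥ 0 at 0 and -(1
  -- - k²)r² < 0 at 1.
  obtain ⟨x, ⟨hx0, hx1⟩, hx⟩ : ∃ x ∈ Ico (0 : ℝ) 1,
      k ^ 2 * x ^ 2 - x * (1 - l ^ 2 * v ^ 2 + k ^ 2 * w ^ 2) + w ^ 2 = 0 := by
    have hc : ContinuousOn (fun x : ℝ =>
        k ^ 2 * x ^ 2 - x * (1 - l ^ 2 * v ^ 2 + k ^ 2 * w ^ 2) + w ^ 2) (Icc 0 1) := by fun_prop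
    obtain ⟨x, hx, h'⟩ := intermediate_value_Icc' zero_le_one hc
      (show (0 : ℝ) ∈ Icc _ _ from ⟨by nlinarith [sq_nonneg r], by simp; positivity⟩)
    refine ⟨x, ⟨hx.1, hx.2.lt_of_ne ?_⟩, h'⟩
    rintro rfl
    simp only at h'
    have : (1 - k ^ 2) * r ^ 2 = 0 := by rw [hl] at h'; linear_combination (1 - k ^ 2) * h - h'
    have : 0 < (1 - k ^ 2) * r ^ 2 := mul_pos (by linarith) (by positivity)
    linarith
  have hd : 0 < 1 - k ^ 2 * x := by nlinarith [sq_nonneg k]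
  obtain ⟨y, hy⟩ : ∃ y, y = v ^ 2 / (1 - k ^ 2 * x) := ⟨_, rfl⟩
  have hy0 : 0 ≤ y := hy ▸ by positivity
  have hv : v ^ 2 = (1 - k ^ 2 * x) * y := by rw [hy]; field_simp
  have hw : w ^ 2 = x * (1 - l ^ 2 * y) := by
    have : (1 - k ^ 2 * x) * (w ^ 2 - x * (1 - l ^ 2 * y)) = 0 := by
      linear_combination hx - x * l ^ 2 * hv
    rcases mul_eq_zero.1 this with h' | h' <;> linarith
  have hrr : r ^ 2 = (1 - x) * (1 - y) := by rw [hl] at hw; linear_combination h - hv - hw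
  have hy1 : y < 1 := by
    have : 0 < (1 - x) * (1 - y) := hrr ▸ by positivity
    linarith [(pos_iff_pos_of_mul_pos this).1 (by linarith)]
  have hy2 : 0 < 1 - l ^ 2 * y := by nlinarith [sq_nonneg l]
  -- Dividing by the positive root lets S and T inherit the signs of w and v.
  have key : ∀ u p q : ℝ, 0 ≤ p → 0 < q → u ^ 2 = p * q → ∃ P, P ^ 2 = p ∧ u = P * √q := by
    intro u p q _ hq hu
    have := Real.sqrt_pos.2 hq
    refine ⟨u / √q, ?_, by field_simp⟩
    rw [div_pow, Real.sq_sqrt hq.le, hu]; field_simp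
  obtain ⟨S, rfl, hS⟩ := key w x _ hx0 hy2 hw
  obtain ⟨T, rfl, hT⟩ := key v y _ hy0 hd (by rw [hv]; ring)
  exact ⟨S, mem_Ioo_of_one_sub_sq_pos (by linarith), T, mem_Ioo_of_one_sub_sq_pos (by linarith),
    hS, by rw [hT, mul_comm], hrr⟩

/-- Sphero-conal coordinates on an open hemisphere: uniqueness. -/
theorem spheroConal_injective {k l S T S' T' : ℝ} (hk0 : 0 < k) (hk1 : k < 1)
    (hl : l ^ 2 = 1 - k ^ 2) (hS : S ^ 2 < 1) (hT : T ^ 2 < 1) (hS' : S' ^ 2 < 1)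
    (hT' : T' ^ 2 < 1) (hw : S * √(1 - l ^ 2 * T ^ 2) = S' * √(1 - l ^ 2 * T' ^ 2))
    (hv : √(1 - k ^ 2 * S ^ 2) * T = √(1 - k ^ 2 * S' ^ 2) * T') : S = S' ∧ T = T' := by
  have hk : k ^ 2 < 1 := by nlinarith
  have hl1 : l ^ 2 < 1 := by nlinarith
  have p1 := one_sub_mul_sq_pos hk hS.le
  have p2 := one_sub_mul_sq_pos hk hS'.le
  have p3 := one_sub_mul_sq_pos hl1 hT.le
  have p4 := one_sub_mul_sq_pos hl1 hT'.le
  have hw2 := congrArg (· ^ 2) hw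
  have hv2 := congrArg (· ^ 2) hv
  simp only [mul_pow] at hw2 hv2
  rw [Real.sq_sqrt p3.le, Real.sq_sqrt p4.le] at hw2
  rw [Real.sq_sqrt p1.le, Real.sq_sqrt p2.le] at hv2
  have e : S ^ 2 = S' ^ 2 := by
    -- As k² + l² = 1, the second factor is k²(1 - S²) + l²(1 - T'²) > 0.
    have : (S ^ 2 - S' ^ 2) * (1 - k ^ 2 * S ^ 2 - l ^ 2 * T' ^ 2) = 0 := by
      linear_combination (1 - k ^ 2 * S ^ 2) * hw2 + l ^ 2 * S ^ 2 * hv2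
    rcases mul_eq_zero.1 this with h' | h'
    · linarith
    · exfalso
      nlinarith [mul_pos (pow_pos hk0 2) (sub_pos.2 hS), mul_nonneg (sq_nonneg l) (sub_pos.2 hT').le]
  rw [e] at hv
  have hT2 := mul_left_cancel₀ (Real.sqrt_pos.2 p2).ne' hv
  rw [hT2] at hw
  exact ⟨mul_right_cancel₀ (Real.sqrt_pos.2 p4).ne' hw, hT2⟩

/-! ### Stereographic projection and system (ii). -/

/-- Inverting the stereographic projection, from R² + z² = (1 + w)/(1 - w), reduces uniqueness to
the sphere. -/
theorem IsBiCyclideCoord.sphere {k s t R z : ℝ} (hk0 : 0 < k) (hk1 : k < 1)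
    (h : IsBiCyclideCoord k s t R z) :
    sn s k * dn t (compl k) = (R ^ 2 + z ^ 2 - 1) / (R ^ 2 + z ^ 2 + 1) ∧
      dn s k * sn t (compl k) = 2 * z / (R ^ 2 + z ^ 2 + 1) := by
  have hk : k ^ 2 < 1 := by nlinarith
  have hl1 := compl_sq_lt_one hk0 hk
  have hc := cn_pos hk h.s_mem
  have hs := sn_sq_add_cn_sq s k
  have ht := sn_sq_add_cn_sq t (compl k)
  have hds := dn_sq hk s
  have hdt := dn_sq hl1 t
  rw [compl_sq hk] at hdt
  have hdp := dn_pos hl1 t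
  have hlt : sn s k * dn t (compl k) < 1 := by
    nlinarith [mul_nonneg (sub_nonneg.2 hk.le) (sq_nonneg (sn t (compl k))), pow_pos hc 2,
      sq_nonneg (sn s k - dn t (compl k))]
  have hne := (sub_pos.2 hlt).ne'
  have hρ : R ^ 2 + z ^ 2 =
      (1 + sn s k * dn t (compl k)) / (1 - sn s k * dn t (compl k)) := by
    rw [h.R_eq, h.z_eq, div_pow, div_pow, ← add_div, div_eq_div_iff (pow_ne_zero 2 hne) hne,
      mul_pow, mul_pow, eq_sub_of_add_eq' hs, eq_sub_of_add_eq' ht, hds]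
    linear_combination (1 - sn s k * dn t (compl k)) * (sn s k) ^ 2 * hdt
  have hz := h.z_eq
  have h2 : R ^ 2 + z ^ 2 + 1 = 2 / (1 - sn s k * dn t (compl k)) := by
    rw [hρ]; field_simp; ring
  rw [h2, hρ, hz]
  constructor
  · field_simp; ring
  · field_simp

theorem existsUnique_isBiCyclideCoord {k R : ℝ} (hk0 : 0 < k) (hk1 : k < 1) (z : ℝ) (hR : 0 < R) :
    ∃! q : ℝ × ℝ, IsBiCyclideCoord k q.1 q.2 R z := by
  have hk : k ^ 2 < 1 := by nlinarith
  have hl1 := compl_sq_lt_one hk0 hk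
  have hl := compl_sq hk
  refine existsUnique_of_exists_of_unique ?_ ?_
  · have hN : 0 < R ^ 2 + z ^ 2 + 1 := by positivity
    obtain ⟨S, hS, T, hT, hw, hv, hr⟩ := exists_spheroConal (r := 2 * R / (R ^ 2 + z ^ 2 + 1))
      (v := 2 * z / (R ^ 2 + z ^ 2 + 1)) (w := (R ^ 2 + z ^ 2 - 1) / (R ^ 2 + z ^ 2 + 1))
      hk0 hk1 hl (by positivity) (by field_simp; ring)
    have hs := ellipticF_arcsin_mem_Ioo hk hS.1 hS.2
    have ht := ellipticF_arcsin_mem_Ioo hl1 hT.1 hT.2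
    have es := sn_ellipticF_arcsin hk hS.1.le hS.2.le
    have et := sn_ellipticF_arcsin hl1 hT.1.le hT.2.le
    refine ⟨(_, _), hs, ht, ?_, ?_⟩
    · have c1 := cn_pos hk hs
      have c2 := cn_pos hl1 ht
      have : cn (ellipticF k (arcsin S)) k * cn (ellipticF (compl k) (arcsin T)) (compl k) =
          2 * R / (R ^ 2 + z ^ 2 + 1) := by
        refine (sq_eq_sq₀ (by positivity) (by positivity)).1 ?_
        rw [hr, mul_pow, eq_sub_of_add_eq' (sn_sq_add_cn_sq _ k), es,
          eq_sub_of_add_eq' (sn_sq_add_cn_sq _ (compl k)), et]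
      change R = cn (ellipticF k (arcsin S)) k * cn (ellipticF (compl k) (arcsin T)) (compl k) /
        (1 - sn (ellipticF k (arcsin S)) k * dn (ellipticF (compl k) (arcsin T)) (compl k))
      rw [this, dn, es, et, ← hw]
      field_simp
      ring
    · change z = dn (ellipticF k (arcsin S)) k * sn (ellipticF (compl k) (arcsin T)) (compl k) /
        (1 - sn (ellipticF k (arcsin S)) k * dn (ellipticF (compl k) (arcsin T)) (compl k))
      rw [dn, dn, es, et, ← hw, ← hv]
      field_simp
      ring
  · rintro ⟨s, t⟩ ⟨s', t'⟩ h h'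
    have e := h.sphere hk0 hk1
    have e' := h'.sphere hk0 hk1
    have lt : ∀ {u m : ℝ}, m ^ 2 < 1 → u ∈ Ioo (-ellipticK m) (ellipticK m) → sn u m ^ 2 < 1 :=
      fun {u m} hm hu => by nlinarith [sn_sq_add_cn_sq u m, pow_pos (cn_pos hm hu) 2]
    obtain ⟨h1, h2⟩ := spheroConal_injective hk0 hk1 hl (lt hk h.s_mem) (lt hl1 h.t_mem)
      (lt hk h'.s_mem) (lt hl1 h'.t_mem) (e.1.trans e'.1.symm) (e.2.trans e'.2.symm)
    exact Prod.ext (sn_injOn hk h.s_mem h'.s_mem h1) (sn_injOn hl1 h.t_mem h'.t_mem h2)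

/-! ### Transformations of sn, cn and dn. -/

theorem am_pos {k u : ℝ} (hk : k ^ 2 < 1) (hu : 0 < u) : 0 < am u k := by
  rwa [← (ellipticF_strictMono hk).lt_iff_lt, ellipticF_am hk, ellipticF_zero]

theorem sn_pos {k u : ℝ} (hk : k ^ 2 < 1) (hu : u ∈ Ioo 0 (ellipticK k)) : 0 < sn u k := by
  have := (am_mem_Ioo hk ⟨by linarith [hu.1, hu.2], hu.2⟩).2
  exact Real.sin_pos_of_pos_of_lt_pi (am_pos hk hu.1) (by linarith [Real.pi_pos])

theorem sn_sq_le_one (u k : ℝ) : sn u k ^ 2 ≤ 1 := Real.sin_sq_le_one _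

/-- Gauss's transformation of the Jacobian elliptic functions. -/
theorem landenUp_sn_cn_dn {κ l μ : ℝ} (h0 : 0 < κ) (h1 : κ < 1)
    (hl : l ^ 2 = 4 * κ / (1 + κ) ^ 2) (hl1 : l ^ 2 < 1)
    (hμ : μ ∈ Ioo (-ellipticK κ) (ellipticK κ)) :
    sn ((1 + κ) * μ) l = landenUp κ (sn μ κ) ∧
      cn ((1 + κ) * μ) l = cn μ κ * dn μ κ / (1 + κ * sn μ κ ^ 2) ∧
      dn ((1 + κ) * μ) l = (1 - κ * sn μ κ ^ 2) / (1 + κ * sn μ κ ^ 2) := by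
  have hκ1 : κ ^ 2 < 1 := by nlinarith
  have hφ := am_mem_Ioo hκ1 hμ
  have tF := ellipticF_landenUp h0 h1 hl hl1 ⟨hφ.1.le, hφ.2.le⟩
  rw [ellipticF_am hκ1, ← sn] at tF
  have X := sn_sq_add_cn_sq μ κ
  have cX := cn_pos hκ1 hμ
  have dX := dn_pos hκ1 μ
  have P := landenUp_denom_pos h0 (sn μ κ)
  have u2 : 1 - landenUp κ (sn μ κ) ^ 2 = (cn μ κ * dn μ κ / (1 + κ * sn μ κ ^ 2)) ^ 2 := by
    rw [one_sub_landenUp_sq h0, div_pow, mul_pow, dn_sq hκ1, eq_sub_of_add_eq' X]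
  have hu := mem_Ioo_of_one_sub_sq_pos (lt_of_lt_of_eq (by positivity) u2.symm)
  have est : sn ((1 + κ) * μ) l = landenUp κ (sn μ κ) := by
    rw [← tF, sn_ellipticF_arcsin hl1 hu.1.le hu.2.le]
  -- The new argument stays within the quarter-period range, which fixes the sign of cn; only
  -- squares remain to be compared.
  have ct := cn_pos hl1 (tF ▸ ellipticF_arcsin_mem_Ioo hl1 hu.1 hu.2)
  refine ⟨est, (sq_eq_sq₀ ct.le (by positivity)).1 ?_,
    (sq_eq_sq₀ (dn_pos hl1 _).le (div_nonneg ?_ P.le)).1 ?_⟩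
  · rw [eq_sub_of_add_eq' (sn_sq_add_cn_sq _ _), est, u2]
  · nlinarith [sn_sq_le_one μ κ]
  · rw [dn_sq hl1, est, hl, one_sub_mul_landenUp_sq h0]

/-- Landen's transformation of the Jacobian elliptic functions, shifted by a quarter period. -/
theorem landenDown_sn_cn_dn {κ l k ν : ℝ} (h0 : 0 < κ) (h1 : κ < 1)
    (hl : l ^ 2 = 1 - κ ^ 2) (hk : k = (1 - κ) / (1 + κ)) (hk1 : k ^ 2 < 1)
    (hν : ν ∈ Ioo 0 (ellipticK l)) :
    sn ((1 + κ) * ν - ellipticK k) k = landenDown κ (sn ν l) ∧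
      cn ((1 + κ) * ν - ellipticK k) k =
        2 * √κ * sn ν l * cn ν l / (1 - (1 - κ) * sn ν l ^ 2) ∧
      dn ((1 + κ) * ν - ellipticK k) k =
        2 * √κ * dn ν l / ((1 + κ) * (1 - (1 - κ) * sn ν l ^ 2)) := by
  have hl1 : l ^ 2 < 1 := by nlinarith
  have hν' : ν ∈ Ioo (-ellipticK l) (ellipticK l) := ⟨by linarith [hν.1, hν.2], hν.2⟩
  have sF := ellipticF_landenDown h0 h1 hl hk hk1
    ⟨(am_pos hl1 hν.1).le, (am_mem_Ioo hl1 hν').2.le⟩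
  rw [ellipticF_am hl1, ← sn, ← eq_sub_iff_add_eq] at sF
  have Y := sn_sq_add_cn_sq ν l
  have Y1 := sn_sq_le_one ν l
  have cY := cn_pos hl1 hν'
  have dY := dn_pos hl1 ν
  have sY := sn_pos hl1 hν
  have Q := landenDown_denom_pos h0 h1 Y1
  have hq := Real.sq_sqrt h0.le
  have u2 : 1 - landenDown κ (sn ν l) ^ 2 =
      (2 * √κ * sn ν l * cn ν l / (1 - (1 - κ) * sn ν l ^ 2)) ^ 2 := by
    rw [one_sub_landenDown_sq h0 h1 Y1, div_pow, mul_pow _ (cn ν l), mul_pow _ (sn ν l),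
      mul_pow 2, hq, eq_sub_of_add_eq' Y]
    norm_num
  have hu := mem_Ioo_of_one_sub_sq_pos (lt_of_lt_of_eq (by positivity) u2.symm)
  have ess : sn ((1 + κ) * ν - ellipticK k) k = landenDown κ (sn ν l) := by
    rw [← sF, sn_ellipticF_arcsin hk1 hu.1.le hu.2.le]
  have cs := cn_pos hk1 (sF ▸ ellipticF_arcsin_mem_Ioo hk1 hu.1 hu.2)
  refine ⟨ess, (sq_eq_sq₀ cs.le (by positivity)).1 ?_,
    (sq_eq_sq₀ (dn_pos hk1 _).le (by positivity)).1 ?_⟩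
  · rw [eq_sub_of_add_eq' (sn_sq_add_cn_sq _ _), ess, u2]
  · rw [dn_sq hk1, ess]
    nth_rw 1 [hk]
    rw [one_sub_mul_landenDown_sq h0 h1 Y1, div_pow, mul_pow _ (dn ν l), mul_pow 2, hq,
      dn_sq hl1, hl]
    norm_num

/-! ### Matching the two systems. -/

/-- The change of variables `(μ, ν) ↦ (s, t)` matches both coordinate systems. -/
theorem isMoonSpencerCoord_iff {k κ : ℝ} (hk0 : 0 < k) (hk1 : k < 1)
    (hκ : κ = (1 - k) / (1 + k)) (μ ν R z : ℝ) :
    IsMoonSpencerCoord (√κ) κ μ ν R z ↔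
      IsBiCyclideCoord k ((1 + κ) * ν - ellipticK k) ((1 + κ) * μ) R z := by
  have hk : k ^ 2 < 1 := by nlinarith
  have h0 : 0 < κ := hκ ▸ div_pos (by linarith) (by linarith)
  have h1 : κ < 1 := by rw [hκ, div_lt_one (by linarith)]; linarith
  have hκ1 : κ ^ 2 < 1 := by nlinarith
  have hkκ : k = (1 - κ) / (1 + κ) := by rw [hκ]; field_simp; ring
  have hl1 := compl_sq_lt_one hk0 hk
  have hl : compl k ^ 2 = 4 * κ / (1 + κ) ^ 2 := by
    rw [compl_sq hk, hkκ]; field_simp; ring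
  have hm1 := compl_sq_lt_one h0 hκ1
  have hm := compl_sq hκ1
  have Kup := ellipticK_landenUp h0 h1 hl hl1
  have Kdown := ellipticK_landenDown h0 h1 hm hkκ hk
  have hp : 0 < 1 + κ := by linarith
  have hμ : (1 + κ) * μ ∈ Ioo (-ellipticK (compl k)) (ellipticK (compl k)) ↔
      μ ∈ Ioo (-ellipticK κ) (ellipticK κ) := by
    rw [Kup, ← mul_neg, mem_Ioo, mem_Ioo, mul_lt_mul_iff_right₀ hp, mul_lt_mul_iff_right₀ hp]
  have hν : (1 + κ) * ν - ellipticK k ∈ Ioo (-ellipticK k) (ellipticK k) ↔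
      ν ∈ Ioo 0 (ellipticK (compl κ)) := by
    rw [mem_Ioo, mem_Ioo, ← mul_lt_mul_iff_right₀ hp (b := ν), ← Kdown, sub_lt_iff_lt_add,
      ← two_mul, neg_lt_sub_iff_lt_add, lt_add_iff_pos_right, mul_pos_iff_of_pos_left hp]
  have key : μ ∈ Ioo (-ellipticK κ) (ellipticK κ) → ν ∈ Ioo 0 (ellipticK (compl κ)) →
      cn ((1 + κ) * ν - ellipticK k) k * cn ((1 + κ) * μ) (compl k) /
        (1 - sn ((1 + κ) * ν - ellipticK k) k * dn ((1 + κ) * μ) (compl k)) =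
      √κ / msDenom κ μ ν * (cn μ κ * dn μ κ * sn ν (compl κ) * cn ν (compl κ)) ∧
      dn ((1 + κ) * ν - ellipticK k) k * sn ((1 + κ) * μ) (compl k) /
        (1 - sn ((1 + κ) * ν - ellipticK k) k * dn ((1 + κ) * μ) (compl k)) =
      √κ / msDenom κ μ ν * (sn μ κ * dn ν (compl κ)) := by
    intro hμ' hν'
    obtain ⟨est, ect, edt⟩ := landenUp_sn_cn_dn h0 h1 hl hl1 hμ'
    obtain ⟨ess, ecs, eds⟩ := landenDown_sn_cn_dn h0 h1 hm hkκ hk hν'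
    have hY1 := sn_sq_le_one ν (compl κ)
    have P := landenUp_denom_pos h0 (sn μ κ)
    have Q := landenDown_denom_pos h0 h1 hY1
    have hΛ : 0 < msDenom κ μ ν := by
      have cY := cn_pos hm1 ⟨by linarith [hν'.1, hν'.2], hν'.2⟩
      rw [msDenom, dn_sq hκ1]
      nlinarith [mul_nonneg (mul_nonneg (sq_nonneg κ) (sq_nonneg (sn μ κ)))
        (sq_nonneg (sn ν (compl κ))), pow_pos cY 2, sn_sq_add_cn_sq ν (compl κ)]
    -- The factor 2 and both Landen denominators cancel against those in the numerators cn · cn and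
    -- dn · sn, leaving √κ/Λ.
    have hden : 1 - sn ((1 + κ) * ν - ellipticK k) k * dn ((1 + κ) * μ) (compl k) =
        2 * msDenom κ μ ν / ((1 - (1 - κ) * sn ν (compl κ) ^ 2) * (1 + κ * sn μ κ ^ 2)) := by
      rw [ess, edt, landenDown, msDenom, dn_sq hκ1, div_mul_div_comm,
        eq_div_iff (mul_pos Q P).ne', sub_mul, div_mul_cancel₀ _ (mul_pos Q P).ne']
      ring
    rw [hden, ecs, ect, eds, est, landenUp]
    generalize msDenom κ μ ν = Λ at *
    generalize 1 - (1 - κ) * sn ν (compl κ) ^ 2 = q at *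
    generalize 1 + κ * sn μ κ ^ 2 = p at *
    clear * - hΛ P Q hp
    constructor <;> field_simp
  constructor
  · intro h
    have e := key h.μ_mem h.ν_mem
    exact ⟨hν.2 h.ν_mem, hμ.2 h.μ_mem, h.R_eq.trans e.1.symm, h.z_eq.trans e.2.symm⟩
  · intro h
    have e := key (hμ.1 h.t_mem) (hν.1 h.s_mem)
    exact ⟨hμ.1 h.t_mem, hν.1 h.s_mem, h.R_eq.trans e.1, h.z_eq.trans e.2⟩

end BiCyclide

theorem mainTheorem12 (k κ a : ℝ) (hk0 : 0 < k) (hk1 : k < 1)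
    (hκ : κ = (1 - k) / (1 + k)) (ha : a = κ ^ (1 / 2 : ℝ))
    (R z : ℝ) (hR : 0 < R) :
    (∃! p : ℝ × ℝ, BiCyclide.IsMoonSpencerCoord a κ p.1 p.2 R z) ∧
    (∃! q : ℝ × ℝ, BiCyclide.IsBiCyclideCoord k q.1 q.2 R z) ∧
    ∀ μ ν s t : ℝ, BiCyclide.IsMoonSpencerCoord a κ μ ν R z →
      BiCyclide.IsBiCyclideCoord k s t R z →
        t = (1 + κ) * μ ∧ s + BiCyclide.ellipticK k = (1 + κ) * ν := by
  rw [← Real.sqrt_eq_rpow] at ha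
  subst ha
  have hp : 0 < 1 + κ := by rw [hκ]; have := div_pos (sub_pos.2 hk1) (by linarith : 0 < 1 + k); linarith
  have hiff := BiCyclide.isMoonSpencerCoord_iff hk0 hk1 hκ
  have hu := BiCyclide.existsUnique_isBiCyclideCoord hk0 hk1 z hR
  refine ⟨?_, hu, fun μ ν s t h h' => ?_⟩
  · obtain ⟨⟨s, t⟩, h, huniq⟩ := hu
    refine ⟨(t / (1 + κ), (s + BiCyclide.ellipticK k) / (1 + κ)), ?_, ?_⟩
    · simp only [hiff]
      rwa [mul_div_cancel₀ _ hp.ne', mul_div_cancel₀ _ hp.ne', add_sub_cancel_right]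
    · rintro ⟨μ, ν⟩ h'
      have := huniq (_, _) ((hiff _ _ _ _).1 h')
      simp only [Prod.mk.injEq] at this ⊢
      rw [← this.1, ← this.2, sub_add_cancel, mul_div_cancel_left₀ _ hp.ne',
        mul_div_cancel_left₀ _ hp.ne']
      exact ⟨rfl, rfl⟩
  · have := hu.unique (y₁ := (s, t)) (y₂ := (_, _)) h' ((hiff _ _ _ _).1 h)
    simp only [Prod.mk.injEq] at this
    exact ⟨this.2, by rw [this.1, sub_add_cancel]⟩
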